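/- Let $n\ge 2$, let $\Omega\subset\mathbb R^n$ be a bounded open set with Lipschitz boundary (near each boundary point, up to a rotation, $\Omega$ is the region strictly above the graph of a Lipschitz function), and let $s\in(0,1)$, $p\in(1,\infty)$. Let $\mathcal R$ be the set of infinitesimal rigid motions $x\mapsto Ax+b$, with $A\in\mathbb R^{n\times n}$ skew-symmetric and $b\in\mathbb R^n$. For a measurable $u:\Omega\to\mathbb R^n$ define $[u]_{\mathcal X^{s,p}(\Omega)}\in[0,\infty]$ by $$[u]_{\mathcal X^{s,p}(\Omega)}^p=\int_\Omega\int_\Omega\frac{\left|(u(y)-u(x))\cdot\frac{y-x}{|y-x|}\right|^p}{|y-x|^{n+ps}}\,dy\,dx ,$$ and let $\mathcal X^{s,p}(\Omega)$ be the closure of the restrictions to $\Omega$ of $C^1_c(\mathbb R^n;\mathbb R^n)$ in the norm $\|u\|_{L^p(\Omega)}+[u]_{\mathcal X^{s,p}(\Omega)}$. (1) There is a constant $C>0$, depending only on $n,p,s,\Omega$, such that for every $u\in\mathcal X^{s,p}(\Omega)$ the minimum below is attained and $$\min_{r\in\mathcal R}\|u-r\|_{L^p(\Omega)}\le C\,[u]_{\mathcal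 X^{s,p}(\Omega)} .$$ (2) Let $V\subset L^p(\Omega;\mathbb R^n)$ be a weakly closed set that is stable under multiplication by positive scalars (for example, a closed linear subspace) and satisfies $V\cap\mathcal R=\{0\}$. Then there is a constant $\tilde C>0$, depending only on $n,p,s,\Omega,V$, such that $$\|u\|_{L^p(\Omega)}\le\tilde C\,[u]_{\mathcal X^{s,p}(\Omega)}\qquad\text{for all }u\in V$$ (the right-hand side being $+\infty$ if $[u]_{\mathcal X^{s,p}(\Omega)}=\infty$). -/

import Mathlib

open MeasureTheory
open scoped ENNReal NNReal RealInnerProductSpace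

noncomputable section

namespace FractionalKorn

/-- A bounded open set with Lipschitz boundary in `ℝⁿ`: around every boundary point, after a choice
of the vertical direction `e` (a unit vector), the set is the part of a ball that lies strictly
above the graph of a Lipschitz function defined on the hyperplane orthogonal to `e`.
Connectedness is not required. -/
structure IsBoundedLipschitzDomain {n : ℕ} (Ω : Set (EuclideanSpace ℝ (Fin n))) : Prop where
  isOpen : IsOpen Ω
  isBounded : Bornology.IsBounded Ω
  locally_epigraph : ∀ x₀ ∈ frontier Ω, ∃ r : ℝ, 0 < r ∧
    ∃ e : EuclideanSpace ℝ (Fin n), ‖e‖ = 1 ∧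
    ∃ (L : ℝ≥0) (f : (ℝ ∙ e)ᗮ → ℝ), LipschitzWith L f ∧
      ∀ x ∈ Metric.ball x₀ r, x ∈ Ω ↔ f ((ℝ ∙ e)ᗮ.orthogonalProjectionOnto x) < ⟪e, x⟫

/-- The infinitesimal rigid motions `x ↦ A x + b` with `A` skew-symmetric. -/
def rigidMotions (n : ℕ) : Set (EuclideanSpace ℝ (Fin n) → EuclideanSpace ℝ (Fin n)) :=
  {r | ∃ (A : Matrix (Fin n) (Fin n) ℝ) (b : EuclideanSpace ℝ (Fin n)),
    A.transpose = -A ∧ ∀ x, r x = Matrix.toEuclideanLin A x + b}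

/-- The seminorm `[u]` of `𝒳^{s,p}(Ω)`, with values in `[0, ∞]`:
`[u]^p = ∫_Ω ∫_Ω |(u(y) - u(x)) · (y - x)/|y - x||^p / |y - x|^(n + p s) dy dx`. -/
def seminormX {n : ℕ} (Ω : Set (EuclideanSpace ℝ (Fin n))) (s : ℝ) (p : ℝ≥0∞)
    (u : EuclideanSpace ℝ (Fin n) → EuclideanSpace ℝ (Fin n)) : ℝ≥0∞ :=
  (∫⁻ x in Ω, ∫⁻ y in Ω,
    ENNReal.ofReal (|⟪u y - u x, ‖y - x‖⁻¹ • (y - x)⟫| ^ p.toReal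
      / ‖y - x‖ ^ ((n : ℝ) + p.toReal * s))) ^ (1 / p.toReal)

/-- The space `𝒳^{s,p}(Ω)`: the closure, for the norm `‖u‖_{L^p(Ω)} + [u]`, of the restrictions to
`Ω` of the compactly supported `C¹` vector fields on `ℝⁿ`. -/
def MemX {n : ℕ} (Ω : Set (EuclideanSpace ℝ (Fin n))) (s : ℝ) (p : ℝ≥0∞)
    (u : EuclideanSpace ℝ (Fin n) → EuclideanSpace ℝ (Fin n)) : Prop :=
  MemLp u p (volume.restrict Ω) ∧ seminormX Ω s p u < ∞ ∧
    ∀ ε : ℝ≥0∞, 0 < ε → ∃ φ : EuclideanSpace ℝ (Fin n) → EuclideanSpace ℝ (Fin n),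
      ContDiff ℝ 1 φ ∧ HasCompactSupport φ ∧
        eLpNorm (u - φ) p (volume.restrict Ω) + seminormX Ω s p (u - φ) < ε

/-- The infinitesimal rigid motions, as elements of `L^p(Ω; ℝⁿ)`. -/
def rigidMotionsLp {n : ℕ} (Ω : Set (EuclideanSpace ℝ (Fin n))) (p : ℝ≥0∞) :
    Set (Lp (EuclideanSpace ℝ (Fin n)) p (volume.restrict Ω)) :=
  {v | ∃ r ∈ rigidMotions n, v =ᵐ[volume.restrict Ω] r}

end FractionalKorn

end

open MeasureTheory
open scoped ENNReal NNReal RealInnerProductSpace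

namespace FractionalKorn

/-! The rigid motion is found by an explicit formula rather than by compactness. Take a bounded
field `Ψ` on `Ω` with `∫ Ψ = 0` and `∫ ⟪y, v⟫ Ψ(y) dy = v`. Expanding the inner product in `G(x) = ∫
⟪u y - u x, y - x⟫ Ψ(y) dy` gives `u = b - D x - G` with `D` linear. Substituting this back into `D
x = ∫ ⟪u y, x⟫ Ψ(y) dy` shows that the symmetric part of `D` is linear in `G`. Hence `u` is a rigid
motion plus terms linear in `G` (`exists_rigid_sub_eq`). Hölder and the lower bound of the kernel on
a bounded set control `G` in `L^p` by the seminorm. The rigid motions form a finite-dimensional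
subspace of `L^p`, so the minimum is attained. A closed cone meeting this subspace only at `0` stays
at a definite angle from it, which turns the first inequality into the second. -/

theorem norm_le_of_enorm_le_coe {F : Type*} [NormedAddCommGroup F] {a : F} {R : ℝ≥0}
    (h : ‖a‖ₑ ≤ R) : ‖a‖ ≤ R :=
  NNReal.coe_le_coe.2 (enorm_le_coe.1 h)

/-! ### Dual field and the decomposition of `u` into a rigid motion and averaged strain. -/

section Abstract

variable {E : Type*} [NormedAddCommGroup E] [InnerProductSpace ℝ E] [MeasurableSpace E]

theorem integrable_inner_smul {μ : Measure E} {u w Ψ : E → E} {R M : ℝ≥0} (hu : Integrable u μ)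
    (hw : AEStronglyMeasurable w μ) (hwR : ∀ᵐ y ∂μ, ‖w y‖ₑ ≤ R)
    (hΨ : AEStronglyMeasurable Ψ μ) (hΨM : ∀ᵐ y ∂μ, ‖Ψ y‖ₑ ≤ M) :
    Integrable (fun y => ⟪u y, w y⟫ • Ψ y) μ := by
  refine (hu.norm.mul_const (R * M : ℝ)).mono' ((hu.1.inner hw).smul hΨ) ?_
  filter_upwards [hwR, hΨM] with y h1 h2
  have h1 : ‖w y‖ ≤ R := norm_le_of_enorm_le_coe h1
  have h2 : ‖Ψ y‖ ≤ M := norm_le_of_enorm_le_coe h2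
  rw [norm_smul, ← mul_assoc]
  have := norm_inner_le_norm (𝕜 := ℝ) (u y) (w y)
  gcongr
  exact this.trans (by gcongr)

/-- The averaged strain `x ↦ ∫ ⟪u y - u x, y - x⟫ Ψ(y) dμ(y)`. -/
noncomputable def averagedStrain (μ : Measure E) (Ψ u : E → E) (x : E) : E :=
  ∫ y, ⟪u y - u x, y - x⟫ • Ψ y ∂μ

/-- Pointwise form of the estimate: only absolute values of the strain remain on the right, one term
a constant and one depending on `x`. -/
theorem enorm_sub_le_of_averagedStrain {μ : Measure E} {u Ψ r : E → E} {R M : ℝ≥0}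
    (hΨM : ∀ᵐ y ∂μ, ‖Ψ y‖ₑ ≤ M)
    (h : ∀ x, u x - r x =
      (1 / 2 : ℝ) • (∫ y, ⟪averagedStrain μ Ψ u y, x⟫ • Ψ y ∂μ) - averagedStrain μ Ψ u x)
    {x : E} (hx : ‖x‖ₑ ≤ R) :
    ‖u x - r x‖ₑ ≤ (R * M * M) * ∫⁻ y, ∫⁻ z, ‖⟪u z - u y, z - y⟫‖ₑ ∂μ ∂μ
      + M * ∫⁻ z, ‖⟪u z - u x, z - x⟫‖ₑ ∂μ := by
  have hG : ∀ y, ‖averagedStrain μ Ψ u y‖ₑ ≤ M * ∫⁻ z, ‖⟪u z - u y, z - y⟫‖ₑ ∂μ := by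
    intro y
    refine (enorm_integral_le_lintegral_enorm _).trans ?_
    rw [← lintegral_const_mul' _ _ ENNReal.coe_ne_top]
    refine lintegral_mono_ae ?_
    filter_upwards [hΨM] with z hz
    rw [enorm_smul, mul_comm]
    gcongr
  have h2 : ‖∫ y, ⟪averagedStrain μ Ψ u y, x⟫ • Ψ y ∂μ‖ₑ ≤
      (R * M * M) * ∫⁻ y, ∫⁻ z, ‖⟪u z - u y, z - y⟫‖ₑ ∂μ ∂μ := by
    refine (enorm_integral_le_lintegral_enorm _).trans ?_
    rw [← lintegral_const_mul' _ _ (by finiteness)]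
    refine lintegral_mono_ae ?_
    filter_upwards [hΨM] with y hy
    have hin : ‖⟪averagedStrain μ Ψ u y, x⟫‖ₑ ≤ ‖averagedStrain μ Ψ u y‖ₑ * ‖x‖ₑ := by
      simp only [← ofReal_norm]
      rw [← ENNReal.ofReal_mul (norm_nonneg _)]
      exact ENNReal.ofReal_le_ofReal (norm_inner_le_norm _ _)
    calc ‖⟪averagedStrain μ Ψ u y, x⟫ • Ψ y‖ₑ
        ≤ ((M * ∫⁻ z, ‖⟪u z - u y, z - y⟫‖ₑ ∂μ) * R) * M := by
          rw [enorm_smul]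
          gcongr
          exact hin.trans (by gcongr; exact hG y)
      _ = _ := by ring
  rw [h x]
  refine (enorm_sub_le).trans (add_le_add ?_ (hG x))
  rw [enorm_smul]
  refine le_trans ?_ h2
  refine mul_le_of_le_one_left (zero_le) ?_
  rw [← ofReal_norm, ENNReal.ofReal_le_one]
  norm_num

variable [FiniteDimensional ℝ E] [BorelSpace E]

/-- On a nonempty bounded open set there is a bounded continuous field `Ψ` that annihilates the
constants and reproduces the linear functions: `∫ Ψ = 0` and `∫ ⟪y, v⟫ Ψ(y) dy = v`. -/
theorem exists_dual_field {Ω : Set E} (ho : IsOpen Ω) (hb : Bornology.IsBounded Ω)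
    (hne : Ω.Nonempty) :
    ∃ (Ψ : E → E) (M : ℝ≥0), Continuous Ψ ∧ (∀ y ∈ Ω, ‖Ψ y‖ₑ ≤ M) ∧
      ∫ y in Ω, Ψ y = 0 ∧ ∀ v : E, ∫ y in Ω, ⟪y, v⟫ • Ψ y = v := by
  have hfin : volume Ω < ∞ := hb.measure_lt_top
  have hint : ∀ f : E → E, Continuous f → IntegrableOn f Ω := fun f hf =>
    (hf.continuousOn.integrableOn_compact hb.isCompact_closure).mono_set subset_closure
  -- Centring at the barycentre gives mean zero to every linear image of `y - c`. The field will be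
  -- `T (y - c)`, with `T` the inverse of the second moment operator `Q`.
  set c : E := ⨍ y in Ω, y with hc
  have hint0 : ∫ y in Ω, (y - c) = 0 := by
    have : IsFiniteMeasure (volume.restrict Ω) := ⟨by simpa using hfin⟩
    exact integral_sub_average _ _
  let Q : E →ₗ[ℝ] E :=
    { toFun := fun v => ∫ y in Ω, ⟪y - c, v⟫ • (y - c)
      map_add' := fun v w => by
        simp only [inner_add_right, add_smul]
        exact integral_add (hint _ (by fun_prop)) (hint _ (by fun_prop))
      map_smul' := fun a v => by
        simp only [inner_smul_right, mul_smul, RingHom.id_apply]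
        exact integral_smul _ _ }
  have hQ : ∀ v, Q v = ∫ y in Ω, ⟪y - c, v⟫ • (y - c) := fun _ => rfl
  -- `⟪Q v, v⟫` is the integral of `⟪y - c, v⟫ ^ 2`. If it vanishes, so does `⟪y - c, v⟫` on the
  -- open set `Ω`, and moving `y` slightly along `v` forces `v = 0`.
  have hinj : Function.Injective Q := by
    rw [injective_iff_map_eq_zero]
    intro v hv
    have h1 : ∫ y in Ω, ⟪y - c, v⟫ ^ 2 = 0 := by
      have := integral_inner (𝕜 := ℝ) (hint (fun y => ⟪y - c, v⟫ • (y - c)) (by fun_prop)) v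
      rw [← hQ, hv, inner_zero_right] at this
      rw [← this]
      congr 1 with y
      rw [inner_smul_right, real_inner_comm v, sq]
    have hsq : Continuous fun y => ⟪y - c, v⟫ ^ 2 := by fun_prop
    rw [setIntegral_eq_zero_iff_of_nonneg_ae (Filter.Eventually.of_forall fun y => sq_nonneg _)
      
      ((hsq.continuousOn.integrableOn_compact hb.isCompact_closure).mono_set subset_closure)] at h1
    have h2 : Set.EqOn (fun y => ⟪y - c, v⟫ ^ 2) 0 Ω :=
      Measure.eqOn_open_of_ae_eq h1 ho hsq.continuousOn continuousOn_const
    obtain ⟨y, hy⟩ := hne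
    have h3 : ∀ᶠ t : ℝ in nhds 0, y + t • v ∈ Ω := by
      have : Filter.Tendsto (fun t : ℝ => y + t • v) (nhds 0) (nhds y) := by
        have h : Continuous fun t : ℝ => y + t • v := by fun_prop
        simpa using h.tendsto 0
      exact this (ho.mem_nhds hy)
    obtain ⟨t, ht, (ht0 : 0 < t)⟩ := ((h3.filter_mono nhdsWithin_le_nhds).and
      (self_mem_nhdsWithin (s := Set.Ioi (0 : ℝ)))).exists
    have e1 : ⟪y - c, v⟫ = 0 := by simpa using h2 hy
    have e2 : ⟪y + t • v - c, v⟫ = 0 := by simpa using h2 ht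
    rw [show y + t • v - c = (y - c) + t • v by abel, inner_add_left, e1, inner_smul_left,
      zero_add] at e2
    simpa [ht0.ne'] using e2
  let T : E →L[ℝ] E := (LinearEquiv.ofInjectiveEndo Q hinj).symm.toLinearMap.toContinuousLinearMap
  have hT : ∀ v, T (Q v) = v := fun v => (LinearEquiv.ofInjectiveEndo Q hinj).symm_apply_apply v
  have hcont : Continuous fun y => T (y - c) := by fun_prop
  obtain ⟨M, hM⟩ := (hb.isCompact_closure.image hcont).isBounded.exists_norm_le
  refine ⟨fun y => T (y - c), M.toNNReal, hcont, fun y hy => ?_, ?_, fun v => ?_⟩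
  · rw [← ofReal_norm]
    exact ENNReal.ofReal_le_ofReal (hM _ ⟨y, subset_closure hy, rfl⟩)
  · rw [T.integral_comp_comm (hint _ (by fun_prop)), hint0, map_zero]
  · have h1 : ∀ y, ⟪y, v⟫ • T (y - c) = T (⟪y - c, v⟫ • (y - c)) + ⟪c, v⟫ • T (y - c) := by
      intro y
      rw [map_smul, ← add_smul, inner_sub_left]
      congr 1; ring
    simp_rw [h1]
    rw [integral_add (hint _ (by fun_prop)) (hint _ (by fun_prop)), integral_smul,
      T.integral_comp_comm (hint _ (by fun_prop)), T.integral_comp_comm (hint _ (by fun_prop)),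
      hint0, ← hQ, hT, map_zero, smul_zero, add_zero]

/-- A field equals a rigid motion up to terms that are linear in its averaged strain. -/
theorem exists_rigid_sub_eq {μ : Measure E} [IsFiniteMeasure μ] {u Ψ : E → E} {R M : ℝ≥0}
    (hu : Integrable u μ) (hR : ∀ᵐ y ∂μ, ‖y‖ₑ ≤ R) (hΨ : AEStronglyMeasurable Ψ μ)
    (hΨM : ∀ᵐ y ∂μ, ‖Ψ y‖ₑ ≤ M) (hΨ0 : ∫ y, Ψ y ∂μ = 0)
    (hΨ1 : ∀ v : E, ∫ y, ⟪y, v⟫ • Ψ y ∂μ = v) :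
    ∃ (A : E →ₗ[ℝ] E) (b : E), LinearMap.adjoint A = -A ∧
      ∀ x, u x - (A x + b) =
        (1 / 2 : ℝ) • (∫ y, ⟪averagedStrain μ Ψ u y, x⟫ • Ψ y ∂μ) - averagedStrain μ Ψ u x := by
  have hid : AEStronglyMeasurable (fun y : E => y) μ := by fun_prop
  have hI : ∀ {w : E → E}, Integrable w μ → ∀ x, Integrable (fun y => ⟪w y, x⟫ • Ψ y) μ :=
    fun hw x => integrable_inner_smul (R := ‖x‖₊) hw aestronglyMeasurable_const
      (Filter.Eventually.of_forall fun _ => le_rfl) hΨ hΨM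
  have hId : Integrable (fun y : E => y) μ :=
    Integrable.of_bound hid R (by
      filter_upwards [hR] with y hy
      exact norm_le_of_enorm_le_coe hy)
  let D : E →ₗ[ℝ] E :=
    { toFun := fun x => ∫ y, ⟪u y, x⟫ • Ψ y ∂μ
      map_add' := fun v w => by
        simp only [inner_add_right, add_smul]
        exact integral_add (hI hu v) (hI hu w)
      map_smul' := fun a v => by
        simp only [inner_smul_right, mul_smul, RingHom.id_apply]
        exact integral_smul _ _ }
  have hD : ∀ x, D x = ∫ y, ⟪u y, x⟫ • Ψ y ∂μ := fun _ => rfl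
  set b : E := ∫ y, ⟪u y, y⟫ • Ψ y ∂μ with hb
  set G := averagedStrain μ Ψ u with hG
  have hΨint : Integrable Ψ μ :=
    Integrable.of_bound hΨ M (by
      filter_upwards [hΨM] with y hy
      exact norm_le_of_enorm_le_coe hy)
  have hc : ∀ a : ℝ, Integrable (fun y => a • Ψ y) μ := fun a => hΨint.smul a
  -- Of the four terms of the expanded inner product, `⟪y, u x⟫` reproduces `u x` and `⟪u x, x⟫` is
  -- killed by `∫ Ψ = 0`.
  have hdec : ∀ x, u x = b - D x - G x := by
    intro x
    have h1 : ∀ y, ⟪u y - u x, y - x⟫ • Ψ y =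
        ⟪u y, y⟫ • Ψ y - ⟪u y, x⟫ • Ψ y - ⟪y, u x⟫ • Ψ y + ⟪u x, x⟫ • Ψ y := by
      intro y
      rw [real_inner_comm (u x) y, ← sub_smul, ← sub_smul, ← add_smul, inner_sub_left,
        inner_sub_right, inner_sub_right]
      congr 1; ring
    have h2 : G x = b - D x - u x := by
      rw [hG, averagedStrain]
      simp_rw [h1]
      have i1 := integrable_inner_smul hu hid hR hΨ hΨM
      have i2 : Integrable (fun y => ⟪u y, y⟫ • Ψ y - ⟪u y, x⟫ • Ψ y) μ := i1.sub (hI hu x)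
      have i3 : Integrable (fun y => ⟪u y, y⟫ • Ψ y - ⟪u y, x⟫ • Ψ y - ⟪y, u x⟫ • Ψ y) μ :=
        i2.sub (hI hId _)
      rw [integral_add i3 (hc _), integral_sub i2 (hI hId _), integral_sub i1 (hI hu x), hΨ1,
        integral_smul, hΨ0, smul_zero, add_zero, hD]
    rw [h2]; abel
  have hDint : Integrable (fun y => D y) μ :=
    (D.toContinuousLinearMap).integrable_comp hId
  -- Integrability is read off the decomposition, so finiteness of the seminorm is not needed.
  have hGint : Integrable G μ := by
    have : G = fun x => b - D x - u x := by
      funext x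
      rw [hdec x]; abel
    rw [this]
    exact ((integrable_const b).sub hDint).sub hu
  -- Insert `u = b - D y - G` into the definition of `D`: the constant drops out and the linear term
  -- returns the adjoint of `D`.
  have hsym : ∀ x, D x + LinearMap.adjoint D x = - ∫ y, ⟪G y, x⟫ • Ψ y ∂μ := by
    intro x
    have h1 : ∀ y, ⟪u y, x⟫ • Ψ y =
        ⟪b, x⟫ • Ψ y - ⟪y, LinearMap.adjoint D x⟫ • Ψ y - ⟪G y, x⟫ • Ψ y := by
      intro y
      rw [LinearMap.adjoint_inner_right, ← sub_smul, ← sub_smul, ← inner_sub_left,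
        ← inner_sub_left, ← hdec]
    have i2 : Integrable (fun y => ⟪b, x⟫ • Ψ y - ⟪y, LinearMap.adjoint D x⟫ • Ψ y) μ :=
      (hc _).sub (hI hId _)
    rw [hD]
    simp_rw [h1]
    rw [integral_sub i2 (hI hGint x),
      integral_sub (hc _) (hI hId _), integral_smul, hΨ0, hΨ1]
    simp only [smul_zero]
    abel
  -- The linear part is minus the skew part of `D`; `hsym` handles the symmetric part.
  refine ⟨-((1 / 2 : ℝ) • (D - LinearMap.adjoint D)), b, ?_, fun x => ?_⟩
  · rw [map_neg, LinearEquiv.map_smulₛₗ, map_sub, LinearMap.adjoint_adjoint, ← smul_neg, neg_sub]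
    simp only [conj_trivial, ← smul_neg, neg_sub]
  · rw [← neg_neg (∫ y, ⟪G y, x⟫ • Ψ y ∂μ), ← hsym, hdec x]
    simp only [LinearMap.neg_apply, LinearMap.smul_apply, LinearMap.sub_apply]
    module

end Abstract

end FractionalKorn

/-! ### From averaged strain to the seminorm: the Poincaré–Korn inequality. -/

namespace FractionalKorn

variable {n : ℕ}

theorem seminormX_congr_ae {Ω : Set (EuclideanSpace ℝ (Fin n))} {s : ℝ} {p : ℝ≥0∞}
    {u v : EuclideanSpace ℝ (Fin n) → EuclideanSpace ℝ (Fin n)}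
    (h : u =ᵐ[volume.restrict Ω] v) : seminormX Ω s p u = seminormX Ω s p v := by
  unfold seminormX
  congr 1
  refine lintegral_congr_ae ?_
  filter_upwards [h] with x hx
  refine lintegral_congr_ae ?_
  filter_upwards [h] with y hy
  rw [hx, hy]

theorem adjoint_eq_neg_mem_rigidMotions
    {A : EuclideanSpace ℝ (Fin n) →ₗ[ℝ] EuclideanSpace ℝ (Fin n)}
    (hA : LinearMap.adjoint A = -A) (b : EuclideanSpace ℝ (Fin n)) :
    (fun x => A x + b) ∈ rigidMotions n := by
  refine ⟨Matrix.toEuclideanLin.symm A, b, ?_, fun x => by simp⟩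
  apply Matrix.toEuclideanLin.injective
  rw [← Matrix.conjTranspose_eq_transpose_of_trivial,
    Matrix.toEuclideanLin_conjTranspose_eq_adjoint, map_neg, LinearEquiv.apply_symm_apply, hA]

/-- The kernel of the seminorm is bounded below on a bounded set. -/
theorem enorm_inner_rpow_le_kernel {u : EuclideanSpace ℝ (Fin n) → EuclideanSpace ℝ (Fin n)}
    {s q d : ℝ} (hq : 0 < q) (hs : 0 < s) {x y : EuclideanSpace ℝ (Fin n)}
    (hd : ‖y - x‖ ≤ d) :
    ‖⟪u y - u x, y - x⟫‖ₑ ^ q ≤ ENNReal.ofReal (d ^ (q + (n + q * s))) *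
      ENNReal.ofReal (|⟪u y - u x, ‖y - x‖⁻¹ • (y - x)⟫| ^ q / ‖y - x‖ ^ ((n : ℝ) + q * s)) := by
  rcases eq_or_ne (y - x) 0 with h | h
  · simp [h, hq]
  have hpos : 0 < ‖y - x‖ := norm_pos_iff.2 h
  rw [← ofReal_norm, ENNReal.ofReal_rpow_of_nonneg (norm_nonneg _) hq.le,
    ← ENNReal.ofReal_mul (Real.rpow_nonneg (hpos.le.trans hd) _)]
  refine ENNReal.ofReal_le_ofReal ?_
  rw [inner_smul_right, abs_mul, abs_inv, abs_norm,
    Real.mul_rpow (inv_nonneg.2 hpos.le) (abs_nonneg _), Real.inv_rpow hpos.le,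
    Real.norm_eq_abs]
  -- One `q` in the exponent undoes the normalisation of `y - x`; `n + q * s` undoes the kernel.
  have h1 : ‖y - x‖ ^ (q + (n + q * s)) ≤ d ^ (q + (n + q * s)) :=
    Real.rpow_le_rpow hpos.le hd (by positivity)
  calc |⟪u y - u x, y - x⟫| ^ q
      = ‖y - x‖ ^ (q + (n + q * s)) *
        ((‖y - x‖ ^ q)⁻¹ * |⟪u y - u x, y - x⟫| ^ q / ‖y - x‖ ^ ((n : ℝ) + q * s)) := by
        rw [Real.rpow_add hpos]
        have := (Real.rpow_pos_of_pos hpos q).ne'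
        have := (Real.rpow_pos_of_pos hpos ((n : ℝ) + q * s)).ne'
        field_simp
    _ ≤ _ := by gcongr

/-- Fractional Poincaré–Korn inequality for a strongly measurable field. -/
theorem exists_poincare_korn_of_measurable {Ω : Set (EuclideanSpace ℝ (Fin n))} (ho : IsOpen Ω)
    (hb : Bornology.IsBounded Ω) (hne : Ω.Nonempty) {s : ℝ} (hs : 0 < s) {p : ℝ≥0∞}
    (hp1 : 1 ≤ p) (hp : p < ∞) :
    ∃ C : ℝ≥0, ∀ u : EuclideanSpace ℝ (Fin n) → EuclideanSpace ℝ (Fin n), Measurable u →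
      MemLp u p (volume.restrict Ω) →
        ∃ r ∈ rigidMotions n, eLpNorm (u - r) p (volume.restrict Ω) ≤ C * seminormX Ω s p u := by
  obtain ⟨Ψ, M, hΨc, hΨM, hΨ0, hΨ1⟩ := exists_dual_field ho hb hne
  obtain ⟨R', hR'⟩ := hb.exists_norm_le
  set R : ℝ≥0 := R'.toNNReal
  have hR : ∀ y ∈ Ω, ‖y‖ₑ ≤ R := fun y hy => by
    rw [← ofReal_norm]
    exact ENNReal.ofReal_le_ofReal (hR' y hy)
  have hfin : IsFiniteMeasure (volume.restrict Ω) := ⟨by simpa using hb.measure_lt_top⟩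
  set μ := volume.restrict Ω with hμ
  have hae : ∀ {P : EuclideanSpace ℝ (Fin n) → Prop}, (∀ y ∈ Ω, P y) → ∀ᵐ y ∂μ, P y :=
    fun h => (ae_restrict_iff' ho.measurableSet).2 (Filter.Eventually.of_forall h)
  have hq1 : 1 ≤ p.toReal := by
    simpa using ENNReal.toReal_mono hp.ne hp1
  have hq : 0 < p.toReal := by linarith
  have hp0 : p ≠ 0 := (zero_lt_one.trans_le hp1).ne'
  set q := p.toReal with hqdef
  -- `V` is the Hölder factor from `L^p` to `L^1`, `V'` the `L^p` norm of the constant `1`, and `K`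
  -- the kernel constant for `‖y - x‖ ≤ 2 * R`.
  set V : ℝ≥0∞ := μ Set.univ ^ (1 - 1 / q) with hV
  set V' : ℝ≥0∞ := μ Set.univ ^ (1 / q) with hV'
  set K : ℝ≥0∞ := ENNReal.ofReal ((2 * R) ^ (q + (n + q * s))) with hK
  have hμf : μ Set.univ ≠ ∞ := measure_ne_top _ _
  have hVf : V ≠ ∞ :=
    ENNReal.rpow_ne_top_of_nonneg (sub_nonneg.2 (by rw [div_le_one hq]; exact hq1)) hμf
  have hVf' : V' ≠ ∞ := ENNReal.rpow_ne_top_of_nonneg (by positivity) hμf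
  have hKf : K ^ (1 / q) ≠ ∞ :=
    ENNReal.rpow_ne_top_of_nonneg (by positivity) ENNReal.ofReal_ne_top
  set c : ℝ≥0∞ := (R * M * M * V * V' + M) * (V * K ^ (1 / q)) with hc
  have hcf : c ≠ ∞ := by finiteness
  refine ⟨c.toNNReal, fun u hum hu => ?_⟩
  rw [ENNReal.coe_toNNReal hcf]
  obtain ⟨A, b, hA, hAb⟩ := exists_rigid_sub_eq (hu.integrable hp1) (hae hR)
    hΨc.aestronglyMeasurable (hae hΨM) hΨ0 hΨ1
  refine ⟨_, adjoint_eq_neg_mem_rigidMotions hA b, ?_⟩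
  set N : EuclideanSpace ℝ (Fin n) → ℝ≥0∞ := fun x => ∫⁻ z, ‖⟪u z - u x, z - x⟫‖ₑ ∂μ with hN
  have hgm : Measurable fun z : EuclideanSpace ℝ (Fin n) × EuclideanSpace ℝ (Fin n) =>
      ‖⟪u z.2 - u z.1, z.2 - z.1⟫‖ₑ := by fun_prop
  have hNm : Measurable N := hgm.lintegral_prod_right'
  have hHol : ∀ f : EuclideanSpace ℝ (Fin n) → ℝ≥0∞, Measurable f →
      ∫⁻ x, f x ∂μ ≤ (∫⁻ x, f x ^ q ∂μ) ^ (1 / q) * V := by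
    intro f hf
    have := eLpNorm_le_eLpNorm_mul_rpow_measure_univ hp1 hf.aestronglyMeasurable (μ := μ)
    rw [eLpNorm_one_eq_lintegral_enorm, eLpNorm_eq_lintegral_rpow_enorm_toReal hp0 hp.ne] at this
    simpa [hV, hqdef] using this
  have hNp : eLpNorm N p μ ≤ V * K ^ (1 / q) * seminormX Ω s p u := by
    rw [eLpNorm_eq_lintegral_rpow_enorm_toReal hp0 hp.ne, seminormX, ← hqdef, mul_assoc,
      ← ENNReal.mul_rpow_of_nonneg _ _ (by positivity : 0 ≤ 1 / q)]
    have hVq : V = (V ^ q) ^ (1 / q) := by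
      rw [← ENNReal.rpow_mul, mul_one_div_cancel hq.ne', ENNReal.rpow_one]
    rw [hVq, ← ENNReal.mul_rpow_of_nonneg _ _ (by positivity : 0 ≤ 1 / q)]
    refine ENNReal.rpow_le_rpow ?_ (by positivity)
    rw [← mul_assoc, ← lintegral_const_mul' _ _ (by finiteness)]
    refine lintegral_mono_ae (hae fun x hx => ?_)
    rw [← lintegral_const_mul' _ _ (by finiteness), enorm_eq_self]
    calc N x ^ q ≤ ((∫⁻ z, ‖⟪u z - u x, z - x⟫‖ₑ ^ q ∂μ) ^ (1 / q) * V) ^ q := by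
          gcongr
          exact hHol _ (by fun_prop)
      _ = V ^ q * ∫⁻ z, ‖⟪u z - u x, z - x⟫‖ₑ ^ q ∂μ := by
          rw [ENNReal.mul_rpow_of_nonneg _ _ hq.le, ← ENNReal.rpow_mul,
            one_div_mul_cancel hq.ne', ENNReal.rpow_one, mul_comm]
      _ ≤ _ := by
          rw [← lintegral_const_mul' _ _ (by finiteness)]
          refine lintegral_mono_ae (hae fun y hy => ?_)
          rw [mul_assoc]
          gcongr
          refine enorm_inner_rpow_le_kernel hq hs ?_
          have h1 := norm_le_of_enorm_le_coe (hR x hx)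
          have h2 := norm_le_of_enorm_le_coe (hR y hy)
          linarith [norm_sub_le y x]
  have hN1 : ∫⁻ x, N x ∂μ ≤ eLpNorm N p μ * V := by
    rw [eLpNorm_eq_lintegral_rpow_enorm_toReal hp0 hp.ne]
    simpa using hHol N hNm
  calc eLpNorm (u - fun x => A x + b) p μ
      ≤ eLpNorm ((fun _ => (R * M * M) * ∫⁻ y, N y ∂μ) + fun x => (M : ℝ≥0∞) * N x) p μ := by
        refine eLpNorm_mono_enorm_ae (hae fun x hx => ?_)
        exact enorm_sub_le_of_averagedStrain (hae hΨM) hAb (hR x hx)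
    _ ≤ _ := eLpNorm_add_le (by fun_prop) (hNm.const_mul _).aestronglyMeasurable hp1
    _ ≤ (R * M * M) * (∫⁻ y, N y ∂μ) * V' + M * eLpNorm N p μ := by
        gcongr
        · rw [eLpNorm_eq_lintegral_rpow_enorm_toReal hp0 hp.ne, lintegral_const,
            ENNReal.mul_rpow_of_nonneg _ _ (by positivity), ← ENNReal.rpow_mul,
            mul_one_div_cancel hq.ne', ENNReal.rpow_one, enorm_eq_self]
        · rw [eLpNorm_eq_lintegral_rpow_enorm_toReal hp0 hp.ne,
            eLpNorm_eq_lintegral_rpow_enorm_toReal hp0 hp.ne]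
          simp only [enorm_eq_self, ← hqdef, ENNReal.mul_rpow_of_nonneg _ _ hq.le]
          rw [lintegral_const_mul' _ _ (by finiteness),
            ENNReal.mul_rpow_of_nonneg _ _ (by positivity), ← ENNReal.rpow_mul,
            mul_one_div_cancel hq.ne', ENNReal.rpow_one]
    _ ≤ (R * M * M) * (eLpNorm N p μ * V) * V' + M * eLpNorm N p μ := by gcongr
    _ = (R * M * M * V * V' + M) * eLpNorm N p μ := by ring
    _ ≤ (R * M * M * V * V' + M) * (V * K ^ (1 / q) * seminormX Ω s p u) := by gcongr
    _ = c * seminormX Ω s p u := by rw [hc]; ring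

/-- Fractional Poincaré–Korn inequality on a bounded open set. -/
theorem exists_poincare_korn {Ω : Set (EuclideanSpace ℝ (Fin n))} (ho : IsOpen Ω)
    (hb : Bornology.IsBounded Ω) {s : ℝ} (hs : 0 < s) {p : ℝ≥0∞} (hp1 : 1 ≤ p) (hp : p < ∞) :
    ∃ C : ℝ≥0, 0 < C ∧ ∀ u : EuclideanSpace ℝ (Fin n) → EuclideanSpace ℝ (Fin n),
      MemLp u p (volume.restrict Ω) →
        ∃ r ∈ rigidMotions n, eLpNorm (u - r) p (volume.restrict Ω) ≤ C * seminormX Ω s p u := by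
  rcases Ω.eq_empty_or_nonempty with rfl | hne
  · exact ⟨1, one_pos, fun u _ => ⟨fun _ => 0, ⟨0, 0, by simp, by simp⟩, by simp⟩⟩
  obtain ⟨C, hC⟩ := exists_poincare_korn_of_measurable ho hb hne hs hp1 hp
  -- Adding `1` makes the constant strictly positive.
  refine ⟨C + 1, by positivity, fun u hu => ?_⟩
  have hae := hu.1.ae_eq_mk
  obtain ⟨r, hr, hle⟩ := hC (hu.1.mk u) hu.1.stronglyMeasurable_mk.measurable (hu.ae_eq hae)
  refine ⟨r, hr, ?_⟩
  rw [seminormX_congr_ae hae, eLpNorm_congr_ae (hae.sub (ae_eq_refl r))]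
  exact hle.trans (by gcongr; simp)

end FractionalKorn

/-! ### Rigid motions as a finite-dimensional subspace; nearest points and closed cones. -/

namespace FractionalKorn

variable {n : ℕ}

theorem memLp_affine {Ω : Set (EuclideanSpace ℝ (Fin n))} (hb : Bornology.IsBounded Ω)
    (p : ℝ≥0∞) (A : Matrix (Fin n) (Fin n) ℝ) (b : EuclideanSpace ℝ (Fin n)) :
    MemLp (fun x => Matrix.toEuclideanLin A x + b) p (volume.restrict Ω) := by
  have hfin : IsFiniteMeasure (volume.restrict Ω) := ⟨by simpa using hb.measure_lt_top⟩
  have hc : Continuous fun x => Matrix.toEuclideanLin A x + b :=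
    (LinearMap.continuous_of_finiteDimensional _).add continuous_const
  obtain ⟨M, hM⟩ := (hb.isCompact_closure.image hc).isBounded.exists_norm_le
  refine MemLp.mono_measure (Measure.restrict_mono subset_closure le_rfl) ?_
  have hfin' : IsFiniteMeasure (volume.restrict (closure Ω)) :=
    ⟨by simpa using hb.isCompact_closure.measure_lt_top⟩
  exact MemLp.of_bound hc.aestronglyMeasurable M
    ((ae_restrict_iff' isClosed_closure.measurableSet).2
      (Filter.Eventually.of_forall fun x hx => hM _ ⟨x, hx, rfl⟩))

/-- The linear map sending `(A, b)` to the class of `x ↦ A x + b` in `L^p(Ω; ℝⁿ)`. -/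
noncomputable def affineToLp {Ω : Set (EuclideanSpace ℝ (Fin n))} (hb : Bornology.IsBounded Ω)
    (p : ℝ≥0∞) : Matrix (Fin n) (Fin n) ℝ × EuclideanSpace ℝ (Fin n) →ₗ[ℝ]
      Lp (EuclideanSpace ℝ (Fin n)) p (volume.restrict Ω) where
  toFun a := (memLp_affine hb p a.1 a.2).toLp
  map_add' a b := by
    rw [← MemLp.toLp_add, MemLp.toLp_eq_toLp_iff]
    refine Filter.Eventually.of_forall fun x => ?_
    simp only [Prod.fst_add, Prod.snd_add, map_add, LinearMap.add_apply, Pi.add_apply]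
    abel
  map_smul' c a := by
    rw [RingHom.id_apply, ← MemLp.toLp_const_smul, MemLp.toLp_eq_toLp_iff]
    refine Filter.Eventually.of_forall fun x => ?_
    simp only [Prod.smul_fst, Prod.smul_snd, map_smul, LinearMap.smul_apply, Pi.smul_apply,
      smul_add]

theorem exists_submodule_eq_rigidMotionsLp {Ω : Set (EuclideanSpace ℝ (Fin n))}
    (hb : Bornology.IsBounded Ω) (p : ℝ≥0∞) :
    ∃ W : Submodule ℝ (Lp (EuclideanSpace ℝ (Fin n)) p (volume.restrict Ω)),
      FiniteDimensional ℝ W ∧ (W : Set _) = rigidMotionsLp Ω p := by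
  let S : Submodule ℝ (Matrix (Fin n) (Fin n) ℝ) :=
    { carrier := {A | A.transpose = -A}
      zero_mem' := by simp
      add_mem' := fun {A B} hA hB => by
        simp only [Set.mem_ofPred_eq] at hA hB ⊢
        rw [Matrix.transpose_add, hA, hB, neg_add]
      smul_mem' := fun c A hA => by
        simp only [Set.mem_ofPred_eq] at hA ⊢
        rw [Matrix.transpose_smul, hA, smul_neg] }
  refine ⟨(S.prod ⊤).map (affineToLp hb p), inferInstance, Set.ext fun v => ⟨?_, ?_⟩⟩
  · rintro ⟨a, ha, rfl⟩
    exact ⟨_, ⟨a.1, a.2, ha.1, fun _ => rfl⟩, MemLp.coeFn_toLp (memLp_affine hb p a.1 a.2)⟩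
  · rintro ⟨r, ⟨A, b, hA, hr⟩, hv⟩
    refine ⟨(A, b), ⟨hA, trivial⟩, Lp.ext ?_⟩
    refine (MemLp.coeFn_toLp (memLp_affine hb p A b)).trans (Filter.EventuallyEq.trans ?_ hv.symm)
    exact Filter.Eventually.of_forall fun x => (hr x).symm

theorem memLp_of_mem_rigidMotions {Ω : Set (EuclideanSpace ℝ (Fin n))}
    (hb : Bornology.IsBounded Ω) (p : ℝ≥0∞)
    {r : EuclideanSpace ℝ (Fin n) → EuclideanSpace ℝ (Fin n)} (hr : r ∈ rigidMotions n) :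
    MemLp r p (volume.restrict Ω) := by
  obtain ⟨A, b, -, h⟩ := hr
  rw [funext h]
  exact memLp_affine hb p A b

/-- A point of a normed space has a nearest point in any finite-dimensional subspace. -/
theorem exists_norm_sub_le_of_finiteDimensional {X : Type*} [NormedAddCommGroup X]
    [NormedSpace ℝ X] (W : Submodule ℝ X) [FiniteDimensional ℝ W] (x : X) :
    ∃ w ∈ W, ∀ w' ∈ W, ‖x - w‖ ≤ ‖x - w'‖ := by
  have hcont : Continuous fun w : W => ‖x - w‖ := by fun_prop
  have hlim : Filter.Tendsto (fun w : W => ‖x - w‖) (Filter.cocompact W) Filter.atTop := by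
    refine Filter.tendsto_atTop_mono (f := fun w : W => ‖w‖ - ‖x‖) (fun w => ?_) ?_
    · have := norm_sub_norm_le (w : X) x
      rw [norm_sub_rev] at this
      exact this
    · have := tendsto_norm_cocompact_atTop (E := W)
      exact Filter.tendsto_atTop_add_const_right _ _ this
  obtain ⟨w, hw⟩ := hcont.exists_forall_le hlim
  exact ⟨w, w.2, fun w' hw' => hw ⟨w', hw'⟩⟩

/-- A closed cone meeting a finite-dimensional subspace only at the origin keeps a distance from
it: the norm on the cone is controlled by the distance to the subspace. -/
theorem exists_norm_le_mul_norm_sub_of_isClosed_cone {X : Type*} [NormedAddCommGroup X]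
    [NormedSpace ℝ X] (W : Submodule ℝ X) [FiniteDimensional ℝ W] {V : Set X}
    (hV : IsClosed V) (hcone : ∀ t : ℝ, 0 < t → ∀ v ∈ V, t • v ∈ V)
    (hVW : V ∩ W ⊆ {0}) :
    ∃ K : ℝ, 0 < K ∧ ∀ v ∈ V, ∀ w ∈ W, ‖v‖ ≤ K * ‖v - w‖ := by
  have hcomp : IsCompact ((↑) '' Metric.sphere (0 : W) 1 : Set X) :=
    (isCompact_sphere _ _).image continuous_subtype_val
  have hdisj : Disjoint ((↑) '' Metric.sphere (0 : W) 1 : Set X) V := by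
    rw [Set.disjoint_left]
    rintro _ ⟨w, hw, rfl⟩ hwV
    have h0 : (w : X) = 0 := hVW ⟨hwV, w.2⟩
    rw [Submodule.coe_eq_zero] at h0
    simp [h0] at hw
  obtain ⟨δ, hδ, hd⟩ := hdisj.exists_thickenings hcomp hV
  have hkey : ∀ v ∈ V, ∀ w ∈ W, δ * ‖w‖ ≤ ‖v - w‖ := by
    intro v hv w hw
    rcases eq_or_ne w 0 with rfl | hw0
    · simp
    have hpos : 0 < ‖w‖ := norm_pos_iff.2 hw0
    -- Rescaling by `‖w‖⁻¹` puts `w` on the unit sphere of `W` and keeps `v` in the cone; `δ`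
    -- separates the compact sphere from `V`.
    have h1 : δ ≤ ‖‖w‖⁻¹ • v - ‖w‖⁻¹ • w‖ := by
      by_contra! hlt
      refine Set.disjoint_left.1 hd ?_
        (Metric.self_subset_thickening hδ _ (hcone _ (inv_pos.2 hpos) v hv))
      refine Metric.mem_thickening_iff.2 ⟨‖w‖⁻¹ • w, ⟨‖w‖⁻¹ • ⟨w, hw⟩, ?_, rfl⟩, ?_⟩
      · simp [norm_smul, hpos.ne']
      · rwa [dist_eq_norm]
    rw [← smul_sub, norm_smul, norm_inv, norm_norm, inv_mul_eq_div, le_div_iff₀ hpos] at h1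
    exact h1
  refine ⟨1 + δ⁻¹, by positivity, fun v hv w hw => ?_⟩
  have h1 : ‖w‖ ≤ δ⁻¹ * ‖v - w‖ := by
    rw [inv_mul_eq_div, le_div_iff₀ hδ, mul_comm]
    exact hkey v hv w hw
  have h2 : ‖v‖ ≤ ‖v - w‖ + ‖w‖ := by simpa using norm_add_le (v - w) w
  linarith

end FractionalKorn

theorem mainTheorem5 (n : ℕ) (hn : 2 ≤ n) (Ω : Set (EuclideanSpace ℝ (Fin n)))
    (hΩ : FractionalKorn.IsBoundedLipschitzDomain Ω)
    (s : ℝ) (hs0 : 0 < s) (hs1 : s < 1)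
    (p : ℝ≥0∞) [Fact (1 ≤ p)] (hp1 : 1 < p) (hp : p < ∞) :
    (∃ C : ℝ≥0, 0 < C ∧
      ∀ u : EuclideanSpace ℝ (Fin n) → EuclideanSpace ℝ (Fin n), FractionalKorn.MemX Ω s p u →
        ∃ r₀ ∈ FractionalKorn.rigidMotions n,
          (∀ r ∈ FractionalKorn.rigidMotions n,
            eLpNorm (u - r₀) p (volume.restrict Ω) ≤ eLpNorm (u - r) p (volume.restrict Ω)) ∧
          eLpNorm (u - r₀) p (volume.restrict Ω) ≤ C * FractionalKorn.seminormX Ω s p u) ∧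
    (∀ V : Set (Lp (EuclideanSpace ℝ (Fin n)) p (volume.restrict Ω)),
      IsClosed (toWeakSpace ℝ (Lp (EuclideanSpace ℝ (Fin n)) p (volume.restrict Ω)) '' V) →
      (∀ t : ℝ, 0 < t → ∀ v ∈ V, t • v ∈ V) →
      V ∩ FractionalKorn.rigidMotionsLp Ω p = {0} →
      ∃ C : ℝ≥0, 0 < C ∧ ∀ u ∈ V,
        eLpNorm u p (volume.restrict Ω) ≤ C * FractionalKorn.seminormX Ω s p u) := by
  obtain ⟨C, hC, hK⟩ := FractionalKorn.exists_poincare_korn hΩ.isOpen hΩ.isBounded hs0 hp1.le hp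
  obtain ⟨W, hWfin, hW⟩ := FractionalKorn.exists_submodule_eq_rigidMotionsLp hΩ.isBounded p
  have hrig := fun {r} => FractionalKorn.memLp_of_mem_rigidMotions (r := r) hΩ.isBounded p
  have hmem : ∀ r (hr : r ∈ FractionalKorn.rigidMotions n), (hrig hr).toLp ∈ W := fun r hr => by
    rw [← SetLike.mem_coe, hW]
    exact ⟨r, hr, (hrig hr).coeFn_toLp⟩
  refine ⟨⟨C, hC, fun u hu => ?_⟩, fun V hV hcone hVR => ?_⟩
  · have hu := hu.1
    obtain ⟨w, hw, hmin⟩ :=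
      FractionalKorn.exists_norm_sub_le_of_finiteDimensional W (hu.toLp)
    obtain ⟨r₀, hr₀, hwr⟩ : w ∈ FractionalKorn.rigidMotionsLp Ω p := hW ▸ hw
    have hwr' : w = (hrig hr₀).toLp := Lp.ext (hwr.trans (hrig hr₀).coeFn_toLp.symm)
    have hle : ∀ r ∈ FractionalKorn.rigidMotions n,
        eLpNorm (u - r₀) p (volume.restrict Ω) ≤ eLpNorm (u - r) p (volume.restrict Ω) := by
      intro r hr
      have h := hmin _ (hmem r hr)
      rw [hwr', ← MemLp.toLp_sub, ← MemLp.toLp_sub, Lp.norm_toLp, Lp.norm_toLp] at h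
      exact (ENNReal.toReal_le_toReal (hu.sub (hrig hr₀)).2.ne (hu.sub (hrig hr)).2.ne).1 h
    obtain ⟨r, hr, hr'⟩ := hK u hu
    exact ⟨r₀, hr₀, hle, (hle r hr).trans hr'⟩
  · have hVcl : IsClosed V := by
      have := hV.preimage (toWeakSpaceCLM ℝ
        (Lp (EuclideanSpace ℝ (Fin n)) p (volume.restrict Ω))).continuous
      convert this using 1
      exact ((toWeakSpace ℝ _).injective.preimage_image V).symm
    obtain ⟨K, hK0, hKV⟩ := FractionalKorn.exists_norm_le_mul_norm_sub_of_isClosed_cone W hVcl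
      hcone (by rw [hW, hVR])
    refine ⟨K.toNNReal * C, by positivity, fun u hu => ?_⟩
    obtain ⟨r, hr, hr'⟩ := hK u (Lp.memLp u)
    have h := hKV u hu _ (hmem r hr)
    have h2 : eLpNorm u p (volume.restrict Ω) ≤
        K.toNNReal * eLpNorm (⇑u - r) p (volume.restrict Ω) := by
      have e : eLpNorm (⇑(u - (hrig hr).toLp)) p (volume.restrict Ω) =
          eLpNorm (⇑u - r) p (volume.restrict Ω) :=
        eLpNorm_congr_ae ((Lp.coeFn_sub _ _).trans
          ((Filter.EventuallyEq.refl _ _).sub (hrig hr).coeFn_toLp))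
      rw [← e, ← Lp.enorm_def, ← Lp.enorm_def, ← ofReal_norm, ← ofReal_norm]
      exact (ENNReal.ofReal_le_ofReal h).trans_eq (ENNReal.ofReal_mul hK0.le)
    calc eLpNorm u p (volume.restrict Ω) ≤ _ := h2
      _ ≤ K.toNNReal * (C * FractionalKorn.seminormX Ω s p u) := by gcongr
      _ = _ := by rw [ENNReal.coe_mul, mul_assoc]
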